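/- For a positive definite quadratic form (PQF) in $d$ variables, given by a real symmetric positive definite matrix $Q$, write $Q[x]=x^{t}Qx$, let $$\mu(Q)=\max_{x\in\mathbb R^d}\ \min_{v\in\mathbb Z^d} Q[x-v]$$ be its inhomogeneous minimum, and let $$\Theta(Q)=\sqrt{\frac{\mu(Q)^d}{\det Q}}\cdot\kappa_d$$ be its covering density, where $\kappa_d$ is the volume of the unit ball of $d$-dimensional Euclidean space. Let $\Theta(\mathsf A_6^*)$ denote the covering density of a Gram matrix of the lattice $\mathsf A_6^*$ dual to the root lattice $\mathsf A_6=\{u\in\mathbb Z^7 : u_1+\dots+u_7=0\}$. Put $$ Q_{\mathsf E_6^*}=\begin{pmatrix}4&1&2&2&-1&1\\1&4&2&2&2&1\\2&2&4&1&1&2\\2&2&1&4&1&2\\-1&2&1&1&4&2\\1&1&2&2&2&4\end{pmatrix},\quad R_2=\begin{pmatrix}0&0&0&0&0&0\\0&5&2&2&3&1\\0&2&4&0&2&2\\0&2&0&4&2&2\\0&3&2&2&5&3\\0&1&2&2&3&5\end{pmatrix}, $$ $$ R_3=\begin{pmatrix}6&4&4&4&0&2\\4&11&6&6&5&3\\4&6&8&3&3&4\\4&6&3&8&3&4\\0&5&3&3&7&4\\2&3&4&4&4&7\end{pmatrix},\quad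 R_4=\begin{pmatrix}3&2&2&2&0&1\\2&3&2&2&1&1\\2&2&4&1&1&2\\2&2&1&4&1&2\\0&1&1&1&3&2\\1&1&2&2&2&4\end{pmatrix}, $$ and $x=0.15266328480099$, $y=0.32884740614948$, $z=0.13827491241153$ (exact decimals). **Theorem.** The matrix $Q=Q_{\mathsf E_6^*}+xR_2+yR_3+zR_4$ is positive definite, and its covering density satisfies $$\Theta(Q)<2.464801 .$$ In particular $\Theta(Q)<\Theta(\mathsf A_6^*)$, where $|\Theta(\mathsf A_6^*)-2.5511|<0.00005$. -/

import Mathlib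

open MeasureTheory

noncomputable section

namespace LatticeCovering

/-- The value `Q[x] = xᵗ Q x` of the quadratic form with symmetric matrix `Q`. -/
def formEval {d : ℕ} (Q : Matrix (Fin d) (Fin d) ℝ) (x : Fin d → ℝ) : ℝ :=
  ∑ i, ∑ j, x i * Q i j * x j

/-- The least value of `Q[x - v]` over the integral vectors `v`. -/
def distToLattice {d : ℕ} (Q : Matrix (Fin d) (Fin d) ℝ) (x : Fin d → ℝ) : ℝ :=
  ⨅ v : Fin d → ℤ, formEval Q (fun i => x i - (v i : ℝ))

/-- The inhomogeneous minimum `μ(Q) = max_{x ∈ ℝᵈ} min_{v ∈ ℤᵈ} Q[x - v]`. The infimum and the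
supremum are over bounded sets whenever `Q` is positive semidefinite, by the two lemmas below. -/
def inhomogeneousMinimum {d : ℕ} (Q : Matrix (Fin d) (Fin d) ℝ) : ℝ :=
  ⨆ x : Fin d → ℝ, distToLattice Q x

theorem bddBelow_formEval {d : ℕ} {Q : Matrix (Fin d) (Fin d) ℝ} (hQ : Q.PosSemidef)
    (x : Fin d → ℝ) :
    BddBelow (Set.range fun v : Fin d → ℤ => formEval Q (fun i => x i - (v i : ℝ))) := by
  refine ⟨0, ?_⟩
  rintro _ ⟨v, rfl⟩
  have h := hQ.dotProduct_mulVec_nonneg (fun i => x i - (v i : ℝ))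
  simpa [formEval, dotProduct, Matrix.mulVec, Finset.mul_sum, mul_assoc] using h

theorem bddAbove_distToLattice {d : ℕ} {Q : Matrix (Fin d) (Fin d) ℝ} (hQ : Q.PosSemidef) :
    BddAbove (Set.range fun x : Fin d → ℝ => distToLattice Q x) := by
  refine ⟨∑ i, ∑ j, |Q i j|, ?_⟩
  rintro _ ⟨x, rfl⟩
  refine (ciInf_le (bddBelow_formEval hQ x) (fun i => ⌊x i⌋)).trans ?_
  refine Finset.sum_le_sum fun i _ => Finset.sum_le_sum fun j _ => ?_
  refine (le_abs_self _).trans ?_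
  have key : ∀ k, |x k - (⌊x k⌋ : ℝ)| ≤ 1 := fun k => by
    rw [abs_le]
    constructor <;> linarith [Int.floor_le (x k), Int.lt_floor_add_one (x k)]
  rw [abs_mul, abs_mul]
  calc |x i - (⌊x i⌋ : ℝ)| * |Q i j| * |x j - (⌊x j⌋ : ℝ)| ≤ 1 * |Q i j| * 1 := by
        gcongr
        · exact key i
        · exact key j
    _ = |Q i j| := by ring

/-- `κ_d`, the volume of the unit ball of `d`-dimensional Euclidean space. -/
def unitBallVolume (d : ℕ) : ℝ :=
  (volume (Metric.closedBall (0 : EuclideanSpace ℝ (Fin d)) 1)).toReal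

/-- The covering density `Θ(Q) = √(μ(Q)ᵈ / det Q) · κ_d` of a positive definite quadratic form. -/
def coveringDensity {d : ℕ} (Q : Matrix (Fin d) (Fin d) ℝ) : ℝ :=
  √(inhomogeneousMinimum Q ^ d / Q.det) * unitBallVolume d

/-- The Gram matrix of the lattice `A_d^*` dual to the root lattice
`A_d = {x ∈ ℤ^{d+1} : ∑ xᵢ = 0}`, in the basis dual to `e₁ - e₂, …, e_d - e_{d+1}`. The Gram matrix
of the latter basis is the Cartan matrix of type `A_d`, and that of the dual basis its inverse. -/
def gramADual (d : ℕ) : Matrix (Fin d) (Fin d) ℝ :=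
  ((CartanMatrix.A d).map (Int.cast : ℤ → ℝ))⁻¹

/-- A positive definite quadratic form of the lattice `E_6^*`. -/
def QE6Dual : Matrix (Fin 6) (Fin 6) ℝ :=
  !![4, 1, 2, 2, -1, 1;
     1, 4, 2, 2, 2, 1;
     2, 2, 4, 1, 1, 2;
     2, 2, 1, 4, 1, 2;
     -1, 2, 1, 1, 4, 2;
     1, 1, 2, 2, 2, 4]

def R₂ : Matrix (Fin 6) (Fin 6) ℝ :=
  !![0, 0, 0, 0, 0, 0;
     0, 5, 2, 2, 3, 1;
     0, 2, 4, 0, 2, 2;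
     0, 2, 0, 4, 2, 2;
     0, 3, 2, 2, 5, 3;
     0, 1, 2, 2, 3, 5]

def R₃ : Matrix (Fin 6) (Fin 6) ℝ :=
  !![6, 4, 4, 4, 0, 2;
     4, 11, 6, 6, 5, 3;
     4, 6, 8, 3, 3, 4;
     4, 6, 3, 8, 3, 4;
     0, 5, 3, 3, 7, 4;
     2, 3, 4, 4, 4, 7]

def R₄ : Matrix (Fin 6) (Fin 6) ℝ :=
  !![3, 2, 2, 2, 0, 1;
     2, 3, 2, 2, 1, 1;
     2, 2, 4, 1, 1, 2;
     2, 2, 1, 4, 1, 2;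
     0, 1, 1, 1, 3, 2;
     1, 1, 2, 2, 2, 4]

/-- The form `Q_{E_6^*} + x R₂ + y R₃ + z R₄` with the given rational `x`, `y`, `z`. -/
def Qcov : Matrix (Fin 6) (Fin 6) ℝ :=
  QE6Dual + (0.15266328480099 : ℝ) • R₂ + (0.32884740614948 : ℝ) • R₃
    + (0.13827491241153 : ℝ) • R₄

end LatticeCovering

end

namespace LatticeCovering

open Matrix

-- The main point is the upper bound on `μ(Q)`. It rests on a finite certificate: a list of
-- squared-distance matrices of simplices, closed under passing to the neighbour across any facet,
-- together with a bound `M` for their squared circumradii. Working with distance matrices instead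
-- of vertices makes the list finite, since integral simplices are then taken up to isometry.
--
-- To find an integral point near `x`, write `x` as an affine combination of the vertices of a
-- simplex and interpolate the function `u ↦ Q[u - x]` affinely from these vertices to the point
-- `x`. The interpolated value equals `ρ - Q[x - c]`, with `c` the circumcenter and `ρ` the squared
-- circumradius, so it depends only on the simplex. If some barycentric coordinate of `x` is
-- negative, a flip across the corresponding facet strictly increases this value, because the new
-- vertex lies outside the circumsphere. Only finitely many integral simplices reach the initial
-- value, so a maximum exists, and a maximal simplex contains `x`. There the value is a convex mean
-- of the `Q[v_k - x]` and is at most `ρ ≤ M`, so some vertex is close enough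
-- (`exists_formEval_sub_castVec_le`). Neither a tiling property nor global emptiness of the spheres
-- is needed.
--
-- For `Qcov` the certificate has eight matrices and is checked in integer arithmetic after scaling
-- by `10 ^ 14`. For `A₆^*` a single matrix suffices, and the bound `4 / 7` is attained at the
-- centroid of the simplex, by an estimate on integers in distinct classes modulo `7`. Determinants
-- and bounds on `π` give the rest.

-- Quadratic form identities and finiteness of balls of integral points.

theorem formEval_eq_dotProduct {d : ℕ} (Q : Matrix (Fin d) (Fin d) ℝ) (x : Fin d → ℝ) :
    formEval Q x = x ⬝ᵥ Q *ᵥ x := by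
  simp [formEval, dotProduct, mulVec, Finset.mul_sum, mul_assoc]

theorem formEval_neg {d : ℕ} (Q : Matrix (Fin d) (Fin d) ℝ) (x : Fin d → ℝ) :
    formEval Q (-x) = formEval Q x := by
  simp [formEval]

theorem formEval_sub_comm {d : ℕ} (Q : Matrix (Fin d) (Fin d) ℝ) (x y : Fin d → ℝ) :
    formEval Q (x - y) = formEval Q (y - x) := by
  rw [← formEval_neg, neg_sub]

theorem formEval_smul {d : ℕ} (Q : Matrix (Fin d) (Fin d) ℝ) (a : ℝ) (x : Fin d → ℝ) :
    formEval Q (a • x) = a ^ 2 * formEval Q x := by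
  simp [formEval_eq_dotProduct, mulVec_smul]; ring

theorem formEval_add {d : ℕ} (Q : Matrix (Fin d) (Fin d) ℝ) (x y : Fin d → ℝ) :
    formEval Q (x + y) = formEval Q x + x ⬝ᵥ Q *ᵥ y + y ⬝ᵥ Q *ᵥ x + formEval Q y := by
  simp only [formEval_eq_dotProduct, mulVec_add, add_dotProduct, dotProduct_add]
  ring

theorem formEval_nonneg {d : ℕ} {Q : Matrix (Fin d) (Fin d) ℝ} (hQ : Q.PosSemidef)
    (x : Fin d → ℝ) : 0 ≤ formEval Q x := by
  simpa [formEval_eq_dotProduct] using hQ.dotProduct_mulVec_nonneg x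

/-- Parallelogram law with the term `Q[x - y]` dropped. It serves as a triangle inequality without
square roots. -/
theorem formEval_add_le {d : ℕ} {Q : Matrix (Fin d) (Fin d) ℝ} (hQ : Q.PosSemidef)
    (x y : Fin d → ℝ) : formEval Q (x + y) ≤ 2 * (formEval Q x + formEval Q y) := by
  have h := formEval_nonneg hQ (x + -y)
  rw [formEval_add, formEval_neg, mulVec_neg, dotProduct_neg, neg_dotProduct] at h
  linarith [formEval_add Q x y]

/-- Weighted mean value identity for a quadratic form. -/
theorem sum_mul_formEval_sub {d n : ℕ} (Q : Matrix (Fin d) (Fin d) ℝ) (p : Fin n → Fin d → ℝ)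
    {a : Fin n → ℝ} (ha : ∑ k, a k = 1) (y : Fin d → ℝ) :
    ∑ k, a k * formEval Q (p k - y) = formEval Q (∑ k, a k • p k - y)
      + ∑ k, a k * formEval Q (p k - ∑ j, a j • p j) := by
  set x := ∑ k, a k • p k with hx
  have h0 : ∑ k, a k • (p k - x) = 0 := by
    simp [smul_sub, Finset.sum_sub_distrib, ← Finset.sum_smul, ha, ← hx]
  have h1 : ∑ k, a k * ((p k - x) ⬝ᵥ Q *ᵥ (x - y)) = 0 := by
    simp_rw [← smul_eq_mul, ← smul_dotProduct, ← sum_dotProduct, h0, zero_dotProduct]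
  have h2 : ∑ k, a k * ((x - y) ⬝ᵥ Q *ᵥ (p k - x)) = 0 := by
    simp_rw [← smul_eq_mul, ← dotProduct_smul, ← mulVec_smul, ← dotProduct_sum, ← mulVec_sum, h0,
      mulVec_zero, dotProduct_zero]
  have h3 : ∀ k, formEval Q (p k - y) = formEval Q (p k - x) + (p k - x) ⬝ᵥ Q *ᵥ (x - y)
      + (x - y) ⬝ᵥ Q *ᵥ (p k - x) + formEval Q (x - y) := fun k => by
    rw [← formEval_add, sub_add_sub_cancel]
  simp_rw [h3, mul_add, Finset.sum_add_distrib, h1, h2, ← Finset.sum_mul, ha]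
  ring

/-- The squared distance of an affine combination of points to a further point, in terms of the
mutual squared distances `D`. -/
theorem formEval_affineCombination_sub {d n : ℕ} (Q : Matrix (Fin d) (Fin d) ℝ)
    {p : Fin n → Fin d → ℝ} {D : Matrix (Fin n) (Fin n) ℝ}
    (hD : ∀ j k, formEval Q (p j - p k) = D j k) {a : Fin n → ℝ} (ha : ∑ k, a k = 1)
    (y : Fin d → ℝ) :
    formEval Q (∑ k, a k • p k - y) = ∑ k, a k * formEval Q (p k - y) - a ⬝ᵥ D *ᵥ a / 2 := by
  have h : a ⬝ᵥ D *ᵥ a = 2 * ∑ k, a k * formEval Q (p k - ∑ j, a j • p j) := by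
    have h1 : a ⬝ᵥ D *ᵥ a = ∑ j, a j * ∑ k, a k * formEval Q (p k - p j) := by
      simp only [dotProduct, mulVec]
      refine Finset.sum_congr rfl fun j _ => congrArg _ (Finset.sum_congr rfl fun k _ => ?_)
      rw [← hD, formEval_sub_comm, mul_comm]
    have h2 : ∑ j, a j * formEval Q (∑ k, a k • p k - p j)
        = ∑ k, a k * formEval Q (p k - ∑ j, a j • p j) :=
      Finset.sum_congr rfl fun j _ => by rw [formEval_sub_comm]
    rw [h1, Finset.sum_congr rfl fun j _ => congrArg (a j * ·) (sum_mul_formEval_sub Q p ha (p j))]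
    simp only [mul_add, Finset.sum_add_distrib, ← Finset.sum_mul, ha, h2]
    ring
  linarith [sum_mul_formEval_sub Q p ha y]

/-- By compactness the form has a positive minimum on the unit sphere, and homogeneity carries the
bound to all vectors. -/
theorem exists_pos_mul_sq_norm_le_formEval {d : ℕ} {Q : Matrix (Fin d) (Fin d) ℝ}
    (hQ : Q.PosDef) : ∃ ε > 0, ∀ x : Fin d → ℝ, ε * ‖x‖ ^ 2 ≤ formEval Q x := by
  have hpos : ∀ x : Fin d → ℝ, x ≠ 0 → 0 < formEval Q x := fun x hx => by
    simpa [formEval_eq_dotProduct] using hQ.dotProduct_mulVec_pos hx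
  have hcont : Continuous (formEval Q) := by unfold formEval; fun_prop
  -- The sphere is empty exactly in dimension `0`.
  rcases (Metric.sphere (0 : Fin d → ℝ) 1).eq_empty_or_nonempty with h | h
  · refine ⟨1, one_pos, fun x => ?_⟩
    have hx : x = 0 := by
      by_contra hx
      have : (‖x‖⁻¹ • x) ∈ Metric.sphere (0 : Fin d → ℝ) 1 := by
        simp [norm_smul, norm_ne_zero_iff.2 hx]
      simp [h] at this
    simp [hx, formEval]
  · obtain ⟨z, hz, hmin⟩ := (isCompact_sphere (0 : Fin d → ℝ) 1).exists_isMinOn h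
      hcont.continuousOn
    refine ⟨formEval Q z, hpos z (by rintro rfl; simp at hz), fun x => ?_⟩
    rcases eq_or_ne x 0 with rfl | hx
    · simp [formEval]
    have hn := norm_ne_zero_iff.2 hx
    have : formEval Q z ≤ formEval Q (‖x‖⁻¹ • x) := hmin (by simp [norm_smul, hn])
    rw [formEval_smul, inv_pow, inv_mul_eq_div, le_div_iff₀ (by positivity)] at this
    exact this

theorem finite_setOf_formEval_intCast_sub_le {d : ℕ} {Q : Matrix (Fin d) (Fin d) ℝ}
    (hQ : Q.PosDef) (x : Fin d → ℝ) (K : ℝ) :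
    {v : Fin d → ℤ | formEval Q ((fun i => (v i : ℝ)) - x) ≤ K}.Finite := by
  obtain ⟨ε, hε, h⟩ := exists_pos_mul_sq_norm_le_formEval hQ
  refine (Set.finite_Icc (fun i => ⌊x i - √(K / ε)⌋) (fun i => ⌈x i + √(K / ε)⌉)).subset ?_
  intro v hv
  have h1 : ‖(fun i => (v i : ℝ)) - x‖ ≤ √(K / ε) := by
    refine Real.le_sqrt_of_sq_le ?_
    rw [le_div_iff₀ hε, mul_comm]
    exact (h _).trans hv
  have h2 : ∀ i, |(v i : ℝ) - x i| ≤ √(K / ε) := fun i =>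
    (norm_le_pi_norm ((fun i => (v i : ℝ)) - x) i).trans h1
  constructor <;> intro i <;> have := abs_le.1 (h2 i)
  · exact Int.cast_le.1 ((Int.floor_le _).trans (by linarith [this.1]) : _ ≤ ((v i : ℤ) : ℝ))
  · exact Int.cast_le.1 (le_trans (by linarith [this.2]) (Int.le_ceil _) : ((v i : ℤ) : ℝ) ≤ _)

/-- Bookkeeping for a vertex exchange: subtracting `t` times the relation `w = ∑ b j • v j` removes
`v k` from a combination and brings in `w` with weight `t`. The arbitrary `f` allows use for the
total weight, for each coordinate and for the interpolated form. -/
theorem sum_update_mul_comp_update {n : ℕ} {α : Type*} (v : Fin n → α) (w : α) (a b : Fin n → ℝ)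
    (k : Fin n) {t : ℝ} (ht : a k - t * b k = 0) (f : α → ℝ) :
    ∑ j, Function.update (fun j => a j - t * b j) k t j * f (Function.update v k w j)
      = ∑ j, a j * f (v j) + t * (f w - ∑ j, b j * f (v j)) := by
  have h1 : ∑ j, Function.update (fun j => a j - t * b j) k t j * f (Function.update v k w j)
      = ∑ j, ((a j - t * b j) * f (v j) + if j = k then t * f w else 0) := by
    refine Finset.sum_congr rfl fun j _ => ?_
    rcases eq_or_ne j k with rfl | hj
    · simp [ht]
    · simp [hj]
  rw [h1, Finset.sum_add_distrib, Finset.sum_ite_eq' Finset.univ k]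
  simp only [sub_mul, Finset.sum_sub_distrib, Finset.mem_univ, if_true, mul_assoc, ← Finset.mul_sum]
  ring

-- Simplices given by distance matrices, flips and circumcenters.

/-- An integral vector, viewed as a real vector. -/
def castVec {d : ℕ} (v : Fin d → ℤ) : Fin d → ℝ := fun i => v i

/-- The integral points `v k` have mutual squared distances `s * D j k` with respect to `Q`. -/
def IsRealization {d n : ℕ} (Q : Matrix (Fin d) (Fin d) ℝ) (s : ℝ) (D : Matrix (Fin n) (Fin n) ℤ)
    (v : Fin n → Fin d → ℤ) : Prop :=
  ∀ j k, formEval Q (castVec (v j) - castVec (v k)) = s * D j k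

/-- In a simplex with squared distances `D`, replacing the vertex `k` by the affine combination `b`
of the vertices, a point beyond the opposite facet and outside the circumscribed sphere, gives a
simplex with squared distances `E`, up to the bijection `σ` of the vertices. -/
structure IsFlip {n : ℕ} (D E : Matrix (Fin n) (Fin n) ℤ) (k : Fin n) (b : Fin n → ℤ)
    (σ : Fin n → Fin n) : Prop where
  injective : Function.Injective σ
  sum_eq_one : ∑ j, b j = 1
  neg : b k < 0
  quad_neg : b ⬝ᵥ D *ᵥ b < 0
  dist_of_ne : ∀ i, i ≠ k → ∀ j, j ≠ k → E (σ i) (σ j) = D i j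
  dist_new : ∀ i, i ≠ k → 2 * E (σ i) (σ k) = 2 * (D *ᵥ b) i - b ⬝ᵥ D *ᵥ b

/-- `g` is a positive multiple of the barycentric coordinates of the circumcenter of a simplex with
squared distances `D`, and the squared circumradius is at most `M`. -/
structure IsCircumcenter {n : ℕ} (D : Matrix (Fin n) (Fin n) ℤ) (g : Fin n → ℤ) (κ M : ℤ) :
    Prop where
  sum_pos : 0 < ∑ j, g j
  mulVec_eq : ∀ i, (D *ᵥ g) i = κ
  le : κ ≤ 2 * M * ∑ j, g j

variable {d n : ℕ} {Q : Matrix (Fin d) (Fin d) ℝ} {s : ℝ} {D E : Matrix (Fin n) (Fin n) ℤ}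
  {v : Fin n → Fin d → ℤ}

theorem dotProduct_mulVec_smul_map (s : ℝ) (D : Matrix (Fin n) (Fin n) ℤ) (b : Fin n → ℤ) :
    castVec b ⬝ᵥ (s • D.map (Int.cast : ℤ → ℝ)) *ᵥ castVec b = s * (b ⬝ᵥ D *ᵥ b : ℤ) := by
  rw [smul_mulVec, dotProduct_smul, smul_eq_mul]
  simp [castVec, dotProduct, mulVec]

theorem castVec_sum_smul (v : Fin n → Fin d → ℤ) (b : Fin n → ℤ) :
    castVec (∑ k, b k • v k) = ∑ k, castVec b k • castVec (v k) := by
  ext i; simp [castVec]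

theorem IsRealization.formEval_affineCombination_sub (hv : IsRealization Q s D v) {a : Fin n → ℝ}
    (ha : ∑ k, a k = 1) (y : Fin d → ℝ) :
    formEval Q (∑ k, a k • castVec (v k) - y) = ∑ k, a k * formEval Q (castVec (v k) - y)
      - a ⬝ᵥ (s • D.map (Int.cast : ℤ → ℝ)) *ᵥ a / 2 :=
  LatticeCovering.formEval_affineCombination_sub Q (p := fun k => castVec (v k))
    (D := s • D.map (Int.cast : ℤ → ℝ)) (fun j k => by simp [hv j k]) ha y

/-- With weights `γ` proportional to `g`, all entries of `D γ` agree, so the distance formula for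
affine combinations gives the same value at every vertex: `s * κ / G`, minus half of it. -/
theorem IsRealization.exists_circumcenter (hs : 0 < s) (hv : IsRealization Q s D v)
    {g : Fin n → ℤ} {κ M : ℤ} (hg : IsCircumcenter D g κ M) :
    ∃ c : Fin d → ℝ, ∃ ρ ≤ s * M, ∀ k, formEval Q (castVec (v k) - c) = ρ := by
  have hG : (0 : ℝ) < ((∑ j, g j : ℤ) : ℝ) := by exact_mod_cast hg.sum_pos
  set G : ℝ := ((∑ j, g j : ℤ) : ℝ) with hGdef
  set γ : Fin n → ℝ := fun j => g j / G with hγ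
  have hγ1 : ∑ j, γ j = 1 := by
    rw [hγ, ← Finset.sum_div, div_eq_one_iff_eq hG.ne', hGdef]; push_cast; rfl
  have hD : ∀ i, ((s • D.map (Int.cast : ℤ → ℝ)) *ᵥ γ) i = s * κ / G := fun i => by
    rw [← hg.mulVec_eq i, smul_mulVec]
    simp [mulVec, dotProduct, hγ, Finset.mul_sum, Finset.sum_div, mul_div_assoc]
  refine ⟨∑ k, γ k • castVec (v k), s * κ / G / 2, ?_, fun i => ?_⟩
  · have h : (κ : ℝ) ≤ 2 * M * G := by rw [hGdef]; exact_mod_cast hg.le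
    rw [div_div, div_le_iff₀ (by positivity)]
    nlinarith
  · rw [formEval_sub_comm, hv.formEval_affineCombination_sub hγ1]
    have h1 : ∑ k, γ k * formEval Q (castVec (v k) - castVec (v i)) = s * κ / G := by
      rw [← hD i]
      simp only [mulVec, dotProduct]
      refine Finset.sum_congr rfl fun k _ => ?_
      rw [formEval_sub_comm, hv i k, mul_comm]; simp
    have h2 : γ ⬝ᵥ (s • D.map (Int.cast : ℤ → ℝ)) *ᵥ γ = s * κ / G := by
      rw [show (s • D.map (Int.cast : ℤ → ℝ)) *ᵥ γ = fun _ => s * κ / G from funext hD]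
      simp only [dotProduct, ← Finset.sum_mul, hγ1, one_mul]
    rw [h1, h2]; ring

/-- Distances to the new vertex come from the formula for affine combinations, which is what
`dist_new` records, doubled to stay within the integers. -/
theorem IsRealization.flip (hv : IsRealization Q s D v) (hE : E.IsSymm) (hE0 : ∀ k, E k k = 0)
    {k : Fin n} {b : Fin n → ℤ} {σ : Fin n → Fin n} (h : IsFlip D E k b σ) :
    IsRealization Q s (E.submatrix σ σ) (Function.update v k (∑ j, b j • v j)) := by
  have hb : ∑ j, castVec b j = 1 := by
    simp only [castVec]; exact_mod_cast h.sum_eq_one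
  have hnew : ∀ i, i ≠ k →
      formEval Q (castVec (∑ j, b j • v j) - castVec (v i)) = s * E (σ i) (σ k) := fun i hi => by
    have h1 : ∑ j, castVec b j * formEval Q (castVec (v j) - castVec (v i))
        = s * ((D *ᵥ b) i : ℤ) := by
      simp only [mulVec, dotProduct, Int.cast_sum, Finset.mul_sum, Int.cast_mul]
      refine Finset.sum_congr rfl fun j _ => ?_
      rw [formEval_sub_comm, hv i j, castVec]; ring
    rw [castVec_sum_smul, hv.formEval_affineCombination_sub hb, dotProduct_mulVec_smul_map, h1]
    have h2 : (2 : ℝ) * E (σ i) (σ k) = 2 * ((D *ᵥ b) i : ℤ) - (b ⬝ᵥ D *ᵥ b : ℤ) := by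
      exact_mod_cast h.dist_new i hi
    linear_combination (-s / 2) * h2
  intro i j
  rcases eq_or_ne i k with hi | hi <;> rcases eq_or_ne j k with hj | hj
  · simp [hi, hj, hE0, formEval]
  · rw [hi, Function.update_self, Function.update_of_ne hj, hnew j hj, submatrix_apply, hE.apply]
  · rw [hj, Function.update_self, Function.update_of_ne hi, formEval_sub_comm, hnew i hi,
      submatrix_apply]
  · rw [Function.update_of_ne hi, Function.update_of_ne hj, hv i j, submatrix_apply,
      h.dist_of_ne i hi j hj]

theorem IsCircumcenter.submatrix {g : Fin n → ℤ} {κ M : ℤ} (hg : IsCircumcenter D g κ M)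
    (e : Fin n ≃ Fin n) : IsCircumcenter (D.submatrix e e) (g ∘ e) κ M where
  sum_pos := by simpa [Equiv.sum_comp e] using hg.sum_pos
  mulVec_eq i := by
    rw [← hg.mulVec_eq (e i)]
    exact Equiv.sum_comp e fun j => D (e i) j * g j
  le := by simpa [Equiv.sum_comp e] using hg.le

theorem IsFlip.submatrix {k : Fin n} {b : Fin n → ℤ} {σ : Fin n → Fin n} (h : IsFlip D E k b σ)
    (e : Fin n ≃ Fin n) :
    IsFlip (D.submatrix e e) E (e.symm k) (b ∘ e) (σ ∘ e) := by
  have h1 : ∀ i, (D.submatrix e e *ᵥ (b ∘ e)) i = (D *ᵥ b) (e i) := fun i =>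
    Equiv.sum_comp e fun j => D (e i) j * b j
  have h2 : (b ∘ e) ⬝ᵥ D.submatrix e e *ᵥ (b ∘ e) = b ⬝ᵥ D *ᵥ b := by
    simp only [dotProduct, h1]
    exact Equiv.sum_comp e fun j => b j * (D *ᵥ b) j
  have hne : ∀ i, i ≠ e.symm k → e i ≠ k := fun i hi hk => hi (by simp [← hk])
  exact
    { injective := h.injective.comp e.injective
      sum_eq_one := by simpa [Equiv.sum_comp e] using h.sum_eq_one
      neg := by simpa using h.neg
      quad_neg := by rw [h2]; exact h.quad_neg
      dist_of_ne := fun i hi j hj => h.dist_of_ne _ (hne i hi) _ (hne j hj)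
      dist_new := fun i hi => by simpa [h1, h2] using h.dist_new _ (hne i hi) }

/-- Let a finite family `D` of squared distance matrices of simplices be closed under flips over
all facets. If one of them is realized by integral points spanning the space, then every vector has
distance at most the largest circumradius from the integral vectors: a realization for which the
affine interpolation of `Q` is maximal at `x` contains `x`. -/
theorem exists_formEval_sub_castVec_le (hQ : Q.PosDef) (hs : 0 < s) {ι : Type*} [Finite ι]
    {D : ι → Matrix (Fin n) (Fin n) ℤ} (hsymm : ∀ i, (D i).IsSymm) (hdiag : ∀ i k, D i k k = 0)
    (hflip : ∀ i k, ∃ j b σ, IsFlip (D i) (D j) k b σ)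
    {M : ℤ} (hcirc : ∀ i, ∃ g κ, IsCircumcenter (D i) g κ M)
    {i₀ : ι} {v₀ : Fin n → Fin d → ℤ} (hv₀ : IsRealization Q s (D i₀) v₀) (x : Fin d → ℝ)
    {a₀ : Fin n → ℝ} (ha₀ : ∑ k, a₀ k = 1) (hx₀ : ∑ k, a₀ k • castVec (v₀ k) = x) :
    ∃ w : Fin d → ℤ, formEval Q (castVec w - x) ≤ s * M := by
  -- `F` consists of all realizations of the family up to relabelling, `A v` of the barycentric
  -- coordinates of `x` in `v`, and `val` is the interpolated form at `x`.
  set F : Set (Fin n → Fin d → ℤ) :=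
    {v | ∃ i, ∃ e : Fin n ≃ Fin n, IsRealization Q s ((D i).submatrix e e) v} with hF
  set val : (Fin n → Fin d → ℤ) → (Fin n → ℝ) → ℝ := fun v a =>
    ∑ k, a k * formEval Q (castVec (v k) - x) with hval
  set A : (Fin n → Fin d → ℤ) → Set (Fin n → ℝ) := fun v =>
    {a | ∑ k, a k = 1 ∧ ∑ k, a k • castVec (v k) = x} with hA
  have hcenter : ∀ v ∈ F, ∃ c : Fin d → ℝ, ∃ ρ ≤ s * M,
      (∀ k, formEval Q (castVec (v k) - c) = ρ) ∧ ∀ a ∈ A v, val v a = ρ - formEval Q (x - c) := by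
    rintro v ⟨i, e, hv⟩
    obtain ⟨g, κ, hg⟩ := hcirc i
    obtain ⟨c, ρ, hρ, hc⟩ := hv.exists_circumcenter hs (hg.submatrix e)
    refine ⟨c, ρ, hρ, hc, fun a ha => ?_⟩
    have h1 := sum_mul_formEval_sub Q (fun k => castVec (v k)) ha.1 c
    simp only [ha.2, hc, ← Finset.sum_mul, ha.1, one_mul] at h1
    linarith
  -- A large value `ρ - Q[x - c]` bounds `Q[x - c]`, hence the distance of every vertex from `x`; so
  -- only finitely many realizations qualify.
  set V : Set (Fin n → Fin d → ℤ) := {v | v ∈ F ∧ ∃ a ∈ A v, val v₀ a₀ ≤ val v a} with hV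
  have hVfin : V.Finite := by
    refine (Set.Finite.pi' fun _ : Fin n => finite_setOf_formEval_intCast_sub_le hQ x
      (2 * (s * M + (s * M - val v₀ a₀)))).subset ?_
    rintro v ⟨hvF, a, ha, hle⟩ k
    obtain ⟨c, ρ, hρ, hc, hca⟩ := hcenter v hvF
    have h1 := formEval_add_le hQ.posSemidef (castVec (v k) - c) (c - x)
    rw [sub_add_sub_cancel, hc, formEval_sub_comm Q c] at h1
    rw [hca a ha] at hle
    exact h1.trans (by linarith)
  set S : Set ℝ := ⋃ v ∈ V, val v '' A v with hS
  have hSfin : S.Finite := hVfin.biUnion fun v hv => by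
    obtain ⟨c, ρ, -, -, hca⟩ := hcenter v hv.1
    -- The value does not depend on the choice of coordinates, so affine independence of the
    -- vertices is not required.
    refine Set.Subsingleton.finite ?_
    rintro _ ⟨a, ha, rfl⟩ _ ⟨b, hb, rfl⟩
    rw [hca a ha, hca b hb]
  have hv₀F : v₀ ∈ F := ⟨i₀, Equiv.refl _, hv₀⟩
  have hSne : S.Nonempty :=
    ⟨_, Set.mem_biUnion (⟨hv₀F, a₀, ⟨ha₀, hx₀⟩, le_rfl⟩ : v₀ ∈ V) ⟨a₀, ⟨ha₀, hx₀⟩, rfl⟩⟩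
  obtain ⟨m, hm, hmax⟩ := hSfin.exists_maximal hSne
  obtain ⟨v, hvV, a, ha, rfl⟩ := Set.mem_iUnion₂.1 hm
  obtain ⟨⟨i, e, hv⟩, a', ha', hle'⟩ := hvV
  have hvF : v ∈ F := ⟨i, e, hv⟩
  obtain ⟨c, ρ, hρ, hc, hca⟩ := hcenter v hvF
  have hle : val v₀ a₀ ≤ val v a := by rwa [hca a ha, ← hca a' ha']
  have hnonneg : ∀ k, 0 ≤ a k := by
    by_contra! hneg
    obtain ⟨k, hk⟩ := hneg
    obtain ⟨j, b, σ, hbσ⟩ := hflip i (e k)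
    have hflip' := hbσ.submatrix e
    rw [e.symm_apply_apply] at hflip'
    set b' := b ∘ e
    have hb1 : ∑ j, castVec b' j = 1 := by
      simp only [castVec]; exact_mod_cast hflip'.sum_eq_one
    have hbk : castVec b' k < 0 := by simpa [castVec] using hflip'.neg
    -- This weight makes the coefficient of the discarded vertex vanish; it is positive as a
    -- quotient of negative numbers.
    set t : ℝ := a k / castVec b' k with ht
    have htpos : 0 < t := div_pos_of_neg_of_neg hk hbk
    have htk : a k - t * castVec b' k = 0 := by rw [ht, div_mul_cancel₀ _ hbk.ne, sub_self]
    set w := ∑ j, b' j • v j with hw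
    set v' := Function.update v k w with hv'
    set a1 := Function.update (fun j => a j - t * castVec b' j) k t with ha1
    have hsum : ∀ f : (Fin d → ℤ) → ℝ, ∑ j, a1 j * f (v' j)
        = ∑ j, a j * f (v j) + t * (f w - ∑ j, castVec b' j * f (v j)) := fun f =>
      sum_update_mul_comp_update v w a (castVec b') k htk f
    have hv'F : v' ∈ F :=
      ⟨j, Equiv.ofBijective _ (Finite.injective_iff_bijective.1 hflip'.injective),
        hv.flip (hsymm j) (hdiag j) hflip'⟩
    have ha1A : a1 ∈ A v' := by
      constructor
      · simpa [ha.1, hb1] using hsum fun _ => 1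
      · rw [← ha.2]
        ext r
        have h1 := hsum fun u => castVec u r
        have h2 : castVec w r = ∑ j, castVec b' j * castVec (v j) r := by
          rw [hw, castVec_sum_smul]; simp
        simpa [h2] using h1
    -- The value grows by `-t * s * (b'ᵗ D b') / 2`, which is positive by `quad_neg`.
    have hlt : val v a < val v' a1 := by
      have h1 := hsum fun u => formEval Q (castVec u - x)
      have h2 := hv.formEval_affineCombination_sub hb1 x
      rw [← castVec_sum_smul, dotProduct_mulVec_smul_map] at h2
      have h3 : ((b' ⬝ᵥ (D i).submatrix e e *ᵥ b' : ℤ) : ℝ) < 0 := by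
        exact_mod_cast hflip'.quad_neg
      have h4 := mul_pos htpos (mul_pos hs (neg_pos.2 h3))
      simp only [hval]
      rw [h1, h2]
      linarith
    exact absurd (hmax (Set.mem_biUnion
      (⟨hv'F, a1, ha1A, hle.trans hlt.le⟩ : v' ∈ V) ⟨a1, ha1A, rfl⟩) hlt.le) (not_le.2 hlt)
  -- Now `x` lies in the simplex, so vertices all farther than `s * M` would force a mean above `s *
  -- M`, whereas the value is `ρ - Q[x - c] ≤ s * M`.
  by_contra! hfar
  have h1 : s * M < val v a := by
    calc s * M = ∑ k, a k * (s * M) := by rw [← Finset.sum_mul, ha.1, one_mul]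
      _ < ∑ k, a k * formEval Q (castVec (v k) - x) := by
        have hne : ∃ k, a k ≠ 0 := by
          by_contra! h0
          simpa [h0] using ha.1
        obtain ⟨k, hk⟩ := hne
        refine Finset.sum_lt_sum (fun j _ => mul_le_mul_of_nonneg_left (hfar _).le (hnonneg j))
          ⟨k, Finset.mem_univ k, mul_lt_mul_of_pos_left (hfar _) (lt_of_le_of_ne (hnonneg k) hk.symm)⟩
  rw [hca a ha] at h1
  linarith [formEval_nonneg hQ.posSemidef (x - c)]

-- Bounds for the inhomogeneous minimum; the volume of the six-dimensional ball.

theorem distToLattice_nonneg (hQ : Q.PosSemidef) (x : Fin d → ℝ) : 0 ≤ distToLattice Q x :=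
  Real.iInf_nonneg fun _ => formEval_nonneg hQ _

theorem inhomogeneousMinimum_nonneg (hQ : Q.PosSemidef) : 0 ≤ inhomogeneousMinimum Q :=
  Real.iSup_nonneg fun _ => distToLattice_nonneg hQ _

theorem inhomogeneousMinimum_le (hQ : Q.PosSemidef) {r : ℝ}
    (h : ∀ x, ∃ w : Fin d → ℤ, formEval Q (castVec w - x) ≤ r) : inhomogeneousMinimum Q ≤ r :=
  ciSup_le fun x => by
    obtain ⟨w, hw⟩ := h x
    rw [formEval_sub_comm] at hw
    exact (ciInf_le (bddBelow_formEval hQ x) w).trans hw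

theorem le_inhomogeneousMinimum (hQ : Q.PosSemidef) {r : ℝ} (x : Fin d → ℝ)
    (h : ∀ w : Fin d → ℤ, r ≤ formEval Q (fun i => x i - w i)) : r ≤ inhomogeneousMinimum Q :=
  (le_ciInf h).trans (le_ciSup (bddAbove_distToLattice hQ) x)

theorem unitBallVolume_six : unitBallVolume 6 = Real.pi ^ 3 / 6 := by
  rw [unitBallVolume, InnerProductSpace.volume_closedBall_of_dim_even (k := 3) (by simp)]
  simp [Nat.factorial, Real.pi_nonneg, div_nonneg]

-- The certificate for `Qcov`.

/-- The squared lengths of the edges of the Delaunay simplices of `Qcov`, scaled by `10 ^ 14`. -/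
def edgeNorm : Fin 12 → ℤ :=
  ![0, 638790917413147, 699856231333543, 748007300428590,
    761834791669743, 779453203804592, 879546262888382, 999949290417333,
    1041431764140792, 1133942981437190, 1185884971425933, 1186798217841737]

/-- The types of the edges of the eight Delaunay simplices of `Qcov`, up to isometry. -/
def edgeType : Fin 8 → Fin 7 → Fin 7 → Fin 12 :=
  ![![![0, 11, 6, 5, 5, 3, 4],
      ![11, 0, 2, 4, 4, 1, 5],
      ![6, 2, 0, 3, 3, 5, 10],
      ![5, 4, 3, 0, 9, 8, 4],
      ![5, 4, 3, 9, 0, 8, 4],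
      ![3, 1, 5, 8, 8, 0, 2],
      ![4, 5, 10, 4, 4, 2, 0]],
    ![![0, 8, 4, 2, 2, 4, 3],
      ![8, 0, 2, 4, 4, 1, 5],
      ![4, 2, 0, 3, 3, 5, 10],
      ![2, 4, 3, 0, 9, 8, 4],
      ![2, 4, 3, 9, 0, 8, 4],
      ![4, 1, 5, 8, 8, 0, 2],
      ![3, 5, 10, 4, 4, 2, 0]],
    ![![0, 10, 6, 5, 5, 3, 4],
      ![10, 0, 4, 2, 2, 4, 3],
      ![6, 4, 0, 3, 3, 5, 10],
      ![5, 2, 3, 0, 9, 8, 4],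
      ![5, 2, 3, 9, 0, 8, 4],
      ![3, 4, 5, 8, 8, 0, 2],
      ![4, 3, 10, 4, 4, 2, 0]],
    ![![0, 11, 4, 5, 5, 3, 4],
      ![11, 0, 5, 4, 4, 1, 5],
      ![4, 5, 0, 4, 4, 2, 9],
      ![5, 4, 4, 0, 9, 8, 4],
      ![5, 4, 4, 9, 0, 8, 4],
      ![3, 1, 2, 8, 8, 0, 2],
      ![4, 5, 9, 4, 4, 2, 0]],
    ![![0, 11, 6, 5, 5, 1, 4],
      ![11, 0, 2, 4, 4, 3, 5],
      ![6, 2, 0, 3, 3, 7, 10],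
      ![5, 4, 3, 0, 9, 2, 4],
      ![5, 4, 3, 9, 0, 2, 4],
      ![1, 3, 7, 2, 2, 0, 8],
      ![4, 5, 10, 4, 4, 8, 0]],
    ![![0, 8, 3, 2, 2, 4, 3],
      ![8, 0, 5, 4, 4, 1, 5],
      ![3, 5, 0, 4, 4, 2, 9],
      ![2, 4, 4, 0, 9, 8, 4],
      ![2, 4, 4, 9, 0, 8, 4],
      ![4, 1, 2, 8, 8, 0, 2],
      ![3, 5, 9, 4, 4, 2, 0]],
    ![![0, 8, 4, 2, 2, 8, 3],
      ![8, 0, 2, 4, 4, 9, 5],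
      ![4, 2, 0, 3, 3, 2, 10],
      ![2, 4, 3, 0, 9, 4, 4],
      ![2, 4, 3, 9, 0, 4, 4],
      ![8, 9, 2, 4, 4, 0, 5],
      ![3, 5, 10, 4, 4, 5, 0]],
    ![![0, 9, 2, 4, 4, 3, 5],
      ![9, 0, 2, 4, 4, 3, 5],
      ![2, 2, 0, 3, 3, 7, 10],
      ![4, 4, 3, 0, 9, 2, 4],
      ![4, 4, 3, 9, 0, 2, 4],
      ![3, 3, 7, 2, 2, 0, 8],
      ![5, 5, 10, 4, 4, 8, 0]]]

/-- The squared distances of the vertices of the Delaunay simplices of `Qcov`, scaled by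
`10 ^ 14`. -/
def delaunayDist (i : Fin 8) : Matrix (Fin 7) (Fin 7) ℤ :=
  Matrix.of fun j k => edgeNorm (edgeType i j k)

/-- The isometry class of the neighbour of a Delaunay simplex across a facet. -/
def flipTarget : Fin 8 → Fin 7 → Fin 8 :=
  ![![1, 2, 3, 0, 0, 4, 0],
    ![0, 2, 5, 1, 1, 6, 1],
    ![1, 0, 6, 2, 2, 2, 2],
    ![5, 6, 0, 4, 4, 3, 0],
    ![7, 4, 3, 4, 4, 0, 4],
    ![3, 6, 1, 5, 5, 7, 1],
    ![7, 1, 3, 2, 2, 1, 5],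
    ![4, 4, 5, 7, 7, 6, 7]]

/-- The barycentric coordinates of the new vertex of the neighbour across a facet. -/
def flipVertex : Fin 8 → Fin 7 → Fin 7 → ℤ :=
  ![![![-1, -1, 0, 1, 1, 1, 0],
      ![-1, -1, 0, 1, 1, 1, 0],
      ![0, 0, -1, 1, 1, 1, -1],
      ![1, 1, 1, -1, -1, -1, 1],
      ![1, 1, 1, -1, -1, -1, 1],
      ![1, 1, 0, 0, 0, -1, 0],
      ![0, 0, -1, 1, 1, 1, -1]],
    ![![-1, -1, 0, 1, 1, 1, 0],
      ![-1, -1, 0, 1, 1, 1, 0],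
      ![0, 0, -1, 1, 1, 1, -1],
      ![0, 0, 1, -1, 0, 0, 1],
      ![0, 0, 1, 0, -1, 0, 1],
      ![0, 0, 1, 0, 0, -1, 1],
      ![0, 0, -1, 1, 1, 1, -1]],
    ![![-1, -1, 0, 1, 1, 1, 0],
      ![-1, -1, 0, 1, 1, 1, 0],
      ![0, 0, -1, 1, 1, 1, -1],
      ![1, 1, 1, -1, -1, -1, 1],
      ![1, 1, 1, -1, -1, -1, 1],
      ![1, 1, 1, -1, -1, -1, 1],
      ![0, 0, -1, 1, 1, 1, -1]],
    ![![-1, -1, 0, 1, 1, 1, 0],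
      ![-1, -1, 0, 1, 1, 1, 0],
      ![0, 0, -1, 1, 1, 1, -1],
      ![1, 1, 1, -1, -1, -1, 1],
      ![1, 1, 1, -1, -1, -1, 1],
      ![1, 1, 0, 0, 0, -1, 0],
      ![0, 0, -1, 1, 1, 1, -1]],
    ![![-1, -1, 1, 0, 0, 1, 1],
      ![-1, -1, 1, 0, 0, 1, 1],
      ![1, 1, -1, 1, 1, -1, -1],
      ![0, 0, 1, -1, -1, 1, 1],
      ![0, 0, 1, -1, -1, 1, 1],
      ![1, 1, 0, 0, 0, -1, 0],
      ![1, 1, -1, 1, 1, -1, -1]],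
    ![![-1, -1, 0, 1, 1, 1, 0],
      ![-1, -1, 0, 1, 1, 1, 0],
      ![0, 0, -1, 1, 1, 1, -1],
      ![1, 1, 1, -1, -1, -1, 1],
      ![1, 1, 1, -1, -1, -1, 1],
      ![0, 0, 1, 0, 0, -1, 1],
      ![0, 0, -1, 1, 1, 1, -1]],
    ![![-1, 0, 0, 1, 1, 0, 0],
      ![0, -1, 1, 0, 0, 0, 1],
      ![1, 1, -1, 0, 0, 1, -1],
      ![1, 1, 0, -1, -1, 1, 0],
      ![1, 1, 0, -1, -1, 1, 0],
      ![0, 0, 1, 0, 0, -1, 1],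
      ![1, 1, -1, 0, 0, 1, -1]],
    ![![-1, -1, 1, 0, 0, 1, 1],
      ![-1, -1, 1, 0, 0, 1, 1],
      ![1, 1, -1, 0, 0, 0, 0],
      ![0, 0, 1, -1, -1, 1, 1],
      ![0, 0, 1, -1, -1, 1, 1],
      ![0, 0, 0, 1, 1, -1, 0],
      ![1, 1, -1, 1, 1, -1, -1]]]

/-- The isometry of the neighbour across a facet with a listed simplex. -/
def flipPerm : Fin 8 → Fin 7 → Fin 7 → Fin 7 :=
  ![![![0, 1, 2, 3, 4, 5, 6],
      ![0, 1, 2, 3, 4, 5, 6],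
      ![0, 1, 2, 3, 4, 5, 6],
      ![0, 1, 2, 3, 4, 5, 6],
      ![0, 1, 2, 3, 4, 5, 6],
      ![0, 1, 2, 3, 4, 5, 6],
      ![0, 1, 2, 3, 4, 5, 6]],
    ![![0, 1, 2, 3, 4, 5, 6],
      ![1, 0, 2, 3, 4, 5, 6],
      ![0, 1, 2, 3, 4, 5, 6],
      ![3, 5, 6, 4, 0, 1, 2],
      ![3, 5, 6, 0, 4, 1, 2],
      ![0, 1, 2, 3, 4, 5, 6],
      ![0, 1, 2, 3, 4, 5, 6]],
    ![![1, 0, 2, 3, 4, 5, 6],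
      ![0, 1, 2, 3, 4, 5, 6],
      ![6, 2, 3, 1, 5, 0, 4],
      ![2, 6, 0, 3, 5, 4, 1],
      ![2, 6, 0, 5, 3, 4, 1],
      ![0, 1, 2, 3, 4, 5, 6],
      ![0, 1, 2, 3, 4, 5, 6]],
    ![![0, 1, 2, 3, 4, 5, 6],
      ![6, 2, 3, 1, 5, 0, 4],
      ![0, 1, 2, 3, 4, 5, 6],
      ![1, 0, 3, 2, 6, 5, 4],
      ![1, 0, 3, 6, 2, 5, 4],
      ![1, 0, 3, 2, 6, 5, 4],
      ![0, 1, 6, 3, 4, 5, 2]],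
    ![![0, 1, 2, 3, 4, 5, 6],
      ![0, 1, 2, 3, 4, 5, 6],
      ![1, 0, 3, 2, 6, 5, 4],
      ![0, 1, 2, 3, 4, 5, 6],
      ![0, 1, 2, 3, 4, 5, 6],
      ![0, 1, 2, 3, 4, 5, 6],
      ![0, 1, 2, 3, 4, 5, 6]],
    ![![0, 1, 2, 3, 4, 5, 6],
      ![2, 6, 3, 1, 5, 0, 4],
      ![0, 1, 2, 3, 4, 5, 6],
      ![0, 1, 2, 3, 4, 5, 6],
      ![0, 1, 2, 3, 4, 5, 6],
      ![5, 6, 0, 3, 4, 2, 1],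
      ![0, 1, 6, 3, 4, 5, 2]],
    ![![5, 0, 2, 3, 4, 1, 6],
      ![0, 5, 2, 3, 4, 1, 6],
      ![5, 3, 1, 2, 6, 4, 0],
      ![5, 3, 1, 2, 6, 4, 0],
      ![5, 3, 1, 6, 2, 4, 0],
      ![0, 1, 2, 3, 4, 5, 6],
      ![5, 3, 0, 2, 6, 4, 1]],
    ![![0, 1, 2, 3, 4, 5, 6],
      ![1, 0, 2, 3, 4, 5, 6],
      ![2, 6, 5, 3, 4, 0, 1],
      ![0, 1, 2, 3, 4, 5, 6],
      ![0, 1, 2, 3, 4, 5, 6],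
      ![1, 5, 2, 3, 4, 0, 6],
      ![3, 4, 5, 0, 1, 2, 6]]]

/-- Multiples of the barycentric coordinates of the circumcenters. -/
def circumcenterCoeff : Fin 8 → Fin 7 → ℤ :=
  ![![1148509580292098290576658346105560674100984,
      718383766564984222947724178243040494469287,
      1105589245497196242582867626338384290655282,
      2554326033541083172286522628187386061884824,
      2554326033541083172286522628187386061884824,
      2184550503085889349465809308132580243777575,
      952745294839752066516257557127855144197114],
    ![108705404943756693888084006406655983307100,
      113243917407180220624103670041552039504331,
      1061450699783508760404341563534511127504214,
      3096297394072097711720072829438774988857300,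
      3096297394072097711720072829438774988857300,
      2789690352243693351789429816334068698742531,
      952745294839752066516257557127855144197114],
    ![1153048092687342343808267056095496584353489,
      718383766496804749443313224598080348524561,
      1168757734123985705472937933288483818647762,
      2486619032519049656164843611247350623639839,
      2486619032519049656164843611247350623639839,
      2252257504176102339091899278717575827967286,
      952745294839752066516257557127855144197114],
    ![1083880268195636821269966389295855279403007,
      810877433950508154206113399645855279403007,
      735272032085846421142955531107620603040969,
      2771799296294988817659824654207620603040969,
      2771799296294988817659824654207620603040969,
      2309530098454271063580722112750000000000000,
      735272032085846421142955531107620603040969],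
    ![1134708308538022343566159503838140917878559,
      924275617318364864800462620175620738246862,
      2892157318899987733111805016538384290655282,
      575667381208574464673451761987386061884824,
      575667381208574464673451761987386061884824,
      2184550503016301871707703184467419756222425,
      2931403947172260774129328423327855144197114],
    ![173334717040218163194775963216361378005077,
      270366896889165621189184848254072219136028,
      779410577799533903321481593911493766192037,
      3205002799015854405608156835845430972164400,
      3205002799015854405608156835845430972164400,
      2805902089801926114419124601337909897115911,
      779410577799533903321481593911493766192037],
    ![2532899255556797447355271611687909897115911,
      2859754451285268695686605165620499477722184,
      625890099111280818184924003195265563590841,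
      672103543459056958252885224157521075048489,
      672103543459056958252885224157521075048489,
      2859754451285268695686605165620499477722184,
      995925113205356943243185877882976404721792],
    ![664038613801266445084965156616427258586156,
      664038613801266445084965156616427258586156,
      2999966449362054079145425294103210945877937,
      575667381208574464673451761987386061884824,
      575667381208574464673451761987386061884824,
      2547411067290991424155277254124306760292173,
      3191640950689359193844825886887048623857820]]

-- Verification of the certificate and the determinant of `Qcov`.

theorem isSymm_delaunayDist : ∀ i, (delaunayDist i).IsSymm := by
  have h : ∀ i j k, delaunayDist i k j - delaunayDist i j k = 0 := by decide +kernel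
  exact fun i => IsSymm.ext fun j k => sub_eq_zero.1 (h i j k)

theorem delaunayDist_self : ∀ i k, delaunayDist i k k = 0 := by decide +kernel

theorem isFlip_delaunayDist (i : Fin 8) (k : Fin 7) :
    IsFlip (delaunayDist i) (delaunayDist (flipTarget i k)) k (flipVertex i k) (flipPerm i k) where
  injective := by revert i k; unfold Function.Injective; decide +kernel
  sum_eq_one := by revert i k; decide +kernel
  neg := by revert i k; decide +kernel
  quad_neg := by
    simp only [dotProduct, mulVec, Fin.sum_univ_seven]
    revert i k; decide +kernel
  dist_of_ne := by
    have h : ∀ i k j, j ≠ k → ∀ l, l ≠ k → delaunayDist (flipTarget i k) (flipPerm i k j)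
        (flipPerm i k l) - delaunayDist i j l = 0 := by decide +kernel
    exact fun j hj l hl => sub_eq_zero.1 (h i k j hj l hl)
  dist_new := by
    simp only [dotProduct, mulVec, Fin.sum_univ_seven]
    revert i k; decide +kernel

theorem isCircumcenter_delaunayDist (i : Fin 8) :
    IsCircumcenter (delaunayDist i) (circumcenterCoeff i)
      ((delaunayDist i *ᵥ circumcenterCoeff i) 0) 363992224784655 where
  sum_pos := by revert i; decide +kernel
  mulVec_eq := by
    simp only [dotProduct, mulVec, Fin.sum_univ_seven]
    revert i; decide +kernel
  le := by revert i; decide +kernel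

/-- The numerators of the entries of `Qcov`, which has the common denominator `10 ^ 14`. -/
def QcovNum : Matrix (Fin 6) (Fin 6) ℤ :=
  !![638790917413147, 259193944942098, 359193944942098, 359193944942098, -100000000000000,
      179596972471049;
    259193944942098, 879546262888382, 455496083132192, 455496083132192, 424050179756190,
      227748041566096;
    359193944942098, 455496083132192, 779453203804592, 212481713085997, 243014370046195,
      389726601902296;
    359193944942098, 455496083132192, 212481713085997, 779453203804592, 243014370046195,
      389726601902296;
    -100000000000000, 424050179756190, 243014370046195, 243014370046195, 748007300428590,
      404992930382395;
    179596972471049, 227748041566096, 389726601902296, 389726601902296, 404992930382395,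
      761834791669743]

set_option maxHeartbeats 1000000 in
theorem Qcov_eq : Qcov = (10 ^ 14 : ℝ)⁻¹ • QcovNum.map (Int.cast : ℤ → ℝ) := by
  ext i j
  simp only [Qcov, Matrix.add_apply, Matrix.smul_apply, Matrix.map_apply, smul_eq_mul]
  fin_cases i <;> fin_cases j <;> norm_num [QcovNum, QE6Dual, R₂, R₃, R₄]

/-- Determinant by expansion along the first row, in a form that reduces in the kernel. -/
def laplaceDet : (n : ℕ) → Matrix (Fin n) (Fin n) ℤ → ℤ
  | 0, _ => 1
  | n + 1, A => ∑ j : Fin (n + 1),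
      (-1) ^ (j : ℕ) * A 0 j * laplaceDet n (A.submatrix Fin.succ j.succAbove)

theorem det_eq_laplaceDet : ∀ (n : ℕ) (A : Matrix (Fin n) (Fin n) ℤ), A.det = laplaceDet n A
  | 0, A => by simp [laplaceDet]
  | n + 1, A => by
      simp only [det_succ_row_zero, laplaceDet, det_eq_laplaceDet n]

theorem det_QcovNum : QcovNum.det =
    10223174392767762252657403886371843805966226733986228099217705904682732250636265121568750 := by
  rw [det_eq_laplaceDet]
  decide +kernel

/-- A Delaunay simplex of `Qcov`. -/
def delaunaySimplex : Fin 7 → Fin 6 → ℤ :=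
  ![![0, 0, 0, 0, 0, 0], ![1, 0, 0, 0, 1, 0], ![0, 1, 0, 0, 0, 0], ![0, 0, 1, 0, 0, 0],
    ![0, 0, 0, 1, 0, 0], ![0, 0, 0, 0, 1, 0], ![0, 0, 0, 0, 0, 1]]

theorem formEval_smul_map_castVec_sub {d : ℕ} (s : ℝ) (A : Matrix (Fin d) (Fin d) ℤ)
    (u v : Fin d → ℤ) :
    formEval (s • A.map (Int.cast : ℤ → ℝ)) (castVec u - castVec v)
      = s * ((u - v) ⬝ᵥ A *ᵥ (u - v) : ℤ) := by
  have h : castVec u - castVec v = castVec (u - v) := by ext; simp [castVec]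
  rw [h, formEval_eq_dotProduct, dotProduct_mulVec_smul_map]

theorem isRealization_delaunaySimplex :
    IsRealization Qcov (10 ^ 14 : ℝ)⁻¹ (delaunayDist 0) delaunaySimplex := by
  have h : ∀ j k, (delaunaySimplex j - delaunaySimplex k) ⬝ᵥ
      QcovNum *ᵥ (delaunaySimplex j - delaunaySimplex k) - delaunayDist 0 j k = 0 := by decide +kernel
  intro j k
  rw [Qcov_eq, formEval_smul_map_castVec_sub, sub_eq_zero.1 (h j k)]

-- Positive definiteness by explicit sums of squares.

theorem posDef_of_formEval_pos {d : ℕ} {Q : Matrix (Fin d) (Fin d) ℝ} (hQ : Q.IsSymm)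
    (h : ∀ x, x ≠ 0 → 0 < formEval Q x) : Q.PosDef :=
  .of_dotProduct_mulVec_pos (by rw [IsHermitian, conjTranspose_eq_transpose_of_trivial]; exact hQ) fun x hx => by
    simpa [formEval_eq_dotProduct] using h x hx

theorem posSemidef_of_formEval_nonneg {d : ℕ} {Q : Matrix (Fin d) (Fin d) ℝ} (hQ : Q.IsSymm)
    (h : ∀ x, 0 ≤ formEval Q x) : Q.PosSemidef :=
  .of_dotProduct_mulVec_nonneg (by rw [IsHermitian, conjTranspose_eq_transpose_of_trivial]; exact hQ) fun x => by
    simpa [formEval_eq_dotProduct] using h x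

/-- Completing squares gives a triangular system of linear forms, so the form vanishes only at the
origin. -/
theorem posDef_QE6Dual : QE6Dual.PosDef := by
  refine posDef_of_formEval_pos (by ext i j; fin_cases i <;> fin_cases j <;> rfl) fun x hx => ?_
  have h : formEval QE6Dual x = 1/4 * (4 * x 0 + x 1 + 2 * x 2 + 2 * x 3 - x 4 + x 5)^2
      + 3/20 * (5 * x 1 + 2 * x 2 + 2 * x 3 + 3 * x 4 + x 5)^2
      + 3/20 * (4 * x 2 - x 3 + x 4 + 2 * x 5)^2 + 1/4 * (3 * x 3 + x 4 + 2 * x 5)^2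
      + 1/2 * (2 * x 4 + x 5)^2 + 3/2 * (x 5)^2 := by
    simp [formEval, QE6Dual, Fin.sum_univ_six]; ring
  have h0 : 0 ≤ formEval QE6Dual x := by rw [h]; positivity
  refine lt_of_le_of_ne h0 fun h1 => hx ?_
  rw [h] at h1
  obtain ⟨h1, e5⟩ := (add_eq_zero_iff_of_nonneg (by positivity) (by positivity)).1 h1.symm
  obtain ⟨h1, e4⟩ := (add_eq_zero_iff_of_nonneg (by positivity) (by positivity)).1 h1
  obtain ⟨h1, e3⟩ := (add_eq_zero_iff_of_nonneg (by positivity) (by positivity)).1 h1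
  obtain ⟨h1, e2⟩ := (add_eq_zero_iff_of_nonneg (by positivity) (by positivity)).1 h1
  obtain ⟨e0, e1⟩ := (add_eq_zero_iff_of_nonneg (by positivity) (by positivity)).1 h1
  norm_num at e0 e1 e2 e3 e4 e5
  ext i
  fin_cases i <;> simp <;> linarith

theorem posSemidef_R₂ : R₂.PosSemidef := by
  refine posSemidef_of_formEval_nonneg (by ext i j; fin_cases i <;> fin_cases j <;> rfl)
    fun x => ?_
  have h : formEval R₂ x = 1/5 * (5 * x 1 + 2 * x 2 + 2 * x 3 + 3 * x 4 + x 5)^2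
      + 1/5 * (4 * x 2 - x 3 + x 4 + 2 * x 5)^2 + 1/3 * (3 * x 3 + x 4 + 2 * x 5)^2
      + 2/3 * (2 * x 4 + x 5)^2 + 2 * (x 5)^2 := by
    simp [formEval, R₂, Fin.sum_univ_six]; ring
  rw [h]; positivity

theorem posSemidef_R₃ : R₃.PosSemidef := by
  refine posSemidef_of_formEval_nonneg (by ext i j; fin_cases i <;> fin_cases j <;> rfl)
    fun x => ?_
  have h : formEval R₃ x = 2/3 * (3 * x 0 + 2 * x 1 + 2 * x 2 + 2 * x 3 + x 5)^2
      + 1/3 * (5 * x 1 + 2 * x 2 + 2 * x 3 + 3 * x 4 + x 5)^2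
      + 1/4 * (4 * x 2 - x 3 + x 4 + 2 * x 5)^2 + 5/12 * (3 * x 3 + x 4 + 2 * x 5)^2
      + 5/6 * (2 * x 4 + x 5)^2 + 5/2 * (x 5)^2 := by
    simp [formEval, R₃, Fin.sum_univ_six]; ring
  rw [h]; positivity

theorem posSemidef_R₄ : R₄.PosSemidef := by
  refine posSemidef_of_formEval_nonneg (by ext i j; fin_cases i <;> fin_cases j <;> rfl)
    fun x => ?_
  have h : formEval R₄ x = 1/3 * (3 * x 0 + 2 * x 1 + 2 * x 2 + 2 * x 3 + x 5)^2
      + 1/15 * (5 * x 1 + 2 * x 2 + 2 * x 3 + 3 * x 4 + x 5)^2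
      + 3/20 * (4 * x 2 - x 3 + x 4 + 2 * x 5)^2 + 1/4 * (3 * x 3 + x 4 + 2 * x 5)^2
      + 1/2 * (2 * x 4 + x 5)^2 + 3/2 * (x 5)^2 := by
    simp [formEval, R₄, Fin.sum_univ_six]; ring
  rw [h]; positivity

theorem posDef_Qcov : Qcov.PosDef :=
  ((posDef_QE6Dual.add_posSemidef (posSemidef_R₂.smul (by norm_num))).add_posSemidef
    (posSemidef_R₃.smul (by norm_num))).add_posSemidef (posSemidef_R₄.smul (by norm_num))

-- The covering density of `Qcov`.

theorem inhomogeneousMinimum_Qcov_le : inhomogeneousMinimum Qcov ≤ 3.63992224784655 := by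
  refine inhomogeneousMinimum_le posDef_Qcov.posSemidef fun x => ?_
  obtain ⟨w, hw⟩ := exists_formEval_sub_castVec_le posDef_Qcov (by positivity) isSymm_delaunayDist
    delaunayDist_self (fun i k => ⟨_, _, _, isFlip_delaunayDist i k⟩)
    (fun i => ⟨_, _, isCircumcenter_delaunayDist i⟩) isRealization_delaunaySimplex x
    -- The second vertex of `delaunaySimplex` is the sum of the first and fifth basis vectors, hence
    -- the correction `x 4 - x 0`.
    (a₀ := ![1 - (x 1 + x 2 + x 3 + x 4 + x 5), x 0, x 1, x 2, x 3, x 4 - x 0, x 5])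
    (by simp [Fin.sum_univ_succ]; ring)
    (by
      ext i
      fin_cases i <;> simp [Fin.sum_univ_succ, castVec, delaunaySimplex])
  exact ⟨w, hw.trans_eq (by norm_num)⟩

theorem det_Qcov : Qcov.det = (10 ^ 84 : ℝ)⁻¹ *
    10223174392767762252657403886371843805966226733986228099217705904682732250636265121568750 := by
  have h : (QcovNum.map (Int.cast : ℤ → ℝ)).det = ((QcovNum.det : ℤ) : ℝ) :=
    ((Int.castRingHom ℝ).map_det QcovNum).symm
  rw [Qcov_eq, det_smul, h, det_QcovNum]
  norm_num

theorem coveringDensity_Qcov_lt : coveringDensity Qcov < 2.464801 := by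
  have hμ := pow_le_pow_left₀ (inhomogeneousMinimum_nonneg posDef_Qcov.posSemidef)
    inhomogeneousMinimum_Qcov_le 6
  -- The constant is a rounded upper bound for the root with `μ` replaced by `3.63992224784655`.
  have h1 : √(inhomogeneousMinimum Qcov ^ 6 / Qcov.det) ≤ 0.47696164 := by
    rw [Real.sqrt_le_left (by norm_num), det_Qcov, div_le_iff₀ (by norm_num)]
    exact hμ.trans (by norm_num)
  have h2 : Real.pi ^ 3 ≤ 3.14159265359 ^ 3 :=
    pow_le_pow_left₀ Real.pi_nonneg (Real.pi_lt_d20.le.trans (by norm_num)) 3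
  rw [coveringDensity, unitBallVolume_six]
  calc _ ≤ 0.47696164 * (3.14159265359 ^ 3 / 6) := by gcongr
    _ < (2.464801 : ℝ) := by norm_num

-- The covering density of `A₆^*`.

/-- Seven times the inverse of the Cartan matrix of type `A₆`. -/
def gramNum : Matrix (Fin 6) (Fin 6) ℤ :=
  !![6, 5, 4, 3, 2, 1;
     5, 10, 8, 6, 4, 2;
     4, 8, 12, 9, 6, 3;
     3, 6, 9, 12, 8, 4;
     2, 4, 6, 8, 10, 5;
     1, 2, 3, 4, 5, 6]

theorem gramADual_six_eq : gramADual 6 = (7 : ℝ)⁻¹ • gramNum.map (Int.cast : ℤ → ℝ) := by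
  have h : CartanMatrix.A 6 * gramNum = (7 : ℤ) • 1 := by decide +kernel
  have h2 : (CartanMatrix.A 6).map (Int.cast : ℤ → ℝ) * gramNum.map (Int.cast : ℤ → ℝ)
      = (7 : ℝ) • 1 := by
    rw [← Matrix.map_mul_intCast, h]
    ext i j
    simp only [map_apply, Matrix.smul_apply, one_apply]
    split_ifs <;> simp
  refine inv_eq_right_inv ?_
  rw [Matrix.mul_smul, h2, smul_smul]
  norm_num

theorem posDef_gramADual_six : (gramADual 6).PosDef := by
  refine PosDef.inv (posDef_of_formEval_pos ?_ fun x hx => ?_)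
  · ext i j; fin_cases i <;> fin_cases j <;> simp [CartanMatrix.A]
  have h : formEval ((CartanMatrix.A 6).map (Int.cast : ℤ → ℝ)) x = x 0 ^ 2 + (x 0 - x 1) ^ 2
      + (x 1 - x 2) ^ 2 + (x 2 - x 3) ^ 2 + (x 3 - x 4) ^ 2 + (x 4 - x 5) ^ 2 + x 5 ^ 2 := by
    simp [formEval, CartanMatrix.A, Fin.sum_univ_six]; ring
  have h0 : 0 ≤ formEval ((CartanMatrix.A 6).map (Int.cast : ℤ → ℝ)) x := by rw [h]; positivity
  refine lt_of_le_of_ne h0 fun h1 => hx ?_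
  rw [h] at h1
  obtain ⟨h1, e6⟩ := (add_eq_zero_iff_of_nonneg (by positivity) (by positivity)).1 h1.symm
  obtain ⟨h1, e5⟩ := (add_eq_zero_iff_of_nonneg (by positivity) (by positivity)).1 h1
  obtain ⟨h1, e4⟩ := (add_eq_zero_iff_of_nonneg (by positivity) (by positivity)).1 h1
  obtain ⟨h1, e3⟩ := (add_eq_zero_iff_of_nonneg (by positivity) (by positivity)).1 h1
  obtain ⟨h1, e2⟩ := (add_eq_zero_iff_of_nonneg (by positivity) (by positivity)).1 h1
  obtain ⟨e0, e1⟩ := (add_eq_zero_iff_of_nonneg (by positivity) (by positivity)).1 h1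
  norm_num at e0 e1 e2 e3 e4 e5 e6
  ext i
  fin_cases i <;> simp <;> linarith

theorem det_gramADual_six : (gramADual 6).det = 7⁻¹ := by
  have h : (CartanMatrix.A 6).det = 7 := by
    rw [det_eq_laplaceDet]; decide +kernel
  have h1 : ((CartanMatrix.A 6).map (Int.cast : ℤ → ℝ)).det = (((CartanMatrix.A 6).det : ℤ) : ℝ) :=
    ((Int.castRingHom ℝ).map_det _).symm
  rw [gramADual, det_nonsing_inv, h1, h]
  simp

/-- The squared distances of the vertices of the Delaunay simplices of `A₆^*`, scaled by `7`. -/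
def cyclicDist : Matrix (Fin 7) (Fin 7) ℤ :=
  .of fun j k => |(j : ℤ) - k| * (7 - |(j : ℤ) - k|)

theorem isSymm_cyclicDist : cyclicDist.IsSymm := by
  have h : ∀ j k, cyclicDist k j - cyclicDist j k = 0 := by decide +kernel
  exact IsSymm.ext fun j k => sub_eq_zero.1 (h j k)

/-- The vertices are the partial sums of seven vectors with sum zero, in cyclic order. Replacing
vertex `k` by the sum of its two neighbours minus itself swaps two consecutive summands, and this
preserves all distances. -/
theorem isFlip_cyclicDist (k : Fin 7) : IsFlip cyclicDist cyclicDist k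
    (fun j => if j = k then -1 else if j = k + 1 ∨ j = k - 1 then 1 else 0) id where
  injective := Function.injective_id
  sum_eq_one := by revert k; decide +kernel
  neg := by revert k; decide +kernel
  quad_neg := by revert k; decide +kernel
  dist_of_ne _ _ _ _ := rfl
  dist_new := by revert k; decide +kernel

/-- Cyclic symmetry puts the circumcenter at the centroid; each row sum is `6 + 10 + 12 + 12 + 10 +
6 = 56`. -/
theorem isCircumcenter_cyclicDist : IsCircumcenter cyclicDist 1 56 4 where
  sum_pos := by decide +kernel
  mulVec_eq := by decide +kernel
  le := by decide +kernel

theorem isRealization_gramADual_six :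
    IsRealization (gramADual 6) (7 : ℝ)⁻¹ cyclicDist (Fin.cons 0 fun j => Pi.single j 1) := by
  have h : ∀ j k : Fin 7, ((Fin.cons 0 fun j => Pi.single j 1 : Fin 7 → Fin 6 → ℤ) j
      - (Fin.cons 0 fun j => Pi.single j 1 : Fin 7 → Fin 6 → ℤ) k) ⬝ᵥ
      gramNum *ᵥ ((Fin.cons 0 fun j => Pi.single j 1 : Fin 7 → Fin 6 → ℤ) j
      - (Fin.cons 0 fun j => Pi.single j 1 : Fin 7 → Fin 6 → ℤ) k) - cyclicDist j k = 0 := by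
    decide +kernel
  intro j k
  rw [gramADual_six_eq, formEval_smul_map_castVec_sub, sub_eq_zero.1 (h j k)]

theorem inhomogeneousMinimum_gramADual_six_le : inhomogeneousMinimum (gramADual 6) ≤ 4 / 7 := by
  refine inhomogeneousMinimum_le posDef_gramADual_six.posSemidef fun x => ?_
  obtain ⟨w, hw⟩ := exists_formEval_sub_castVec_le posDef_gramADual_six (by positivity)
    (ι := Unit) (D := fun _ => cyclicDist) (i₀ := ())
    (fun _ => isSymm_cyclicDist) (fun _ => by decide +kernel)
    (fun _ k => ⟨(), _, _, isFlip_cyclicDist k⟩) (fun _ => ⟨_, _, isCircumcenter_cyclicDist⟩)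
    isRealization_gramADual_six x (a₀ := Fin.cons (1 - ∑ i, x i) x)
    (by simp [Fin.sum_univ_succ (n := 6)])
    (by
      ext i
      simp [Fin.sum_univ_succ (n := 6), castVec, Pi.single_apply])
  exact ⟨w, hw.trans_eq (by norm_num)⟩

/-- Integers in distinct classes modulo `7` have variance at least `4`. -/
theorem le_sum_sub_sq {a : Fin 7 → ℤ} (ha : ∀ j, a j % 7 = (j : ℕ)) (m : ℤ) :
    28 ≤ ∑ j, (a j - m) ^ 2 := by
  -- `(z + 3) % 7 - 3` is the residue of `z` of least absolute value. Over the seven classes these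
  -- residues are `-3, …, 3`, with square sum `28`.
  have key : ∀ z : ℤ, ((z + 3) % 7 - 3) ^ 2 ≤ z ^ 2 := fun z => by
    have h1 := Int.emod_add_mul_ediv (z + 3) 7
    have h2 := Int.emod_nonneg (z + 3) (show (7 : ℤ) ≠ 0 by norm_num)
    have h3 := Int.emod_lt_of_pos (z + 3) (show (0 : ℤ) < 7 by norm_num)
    set q := (z + 3) / 7
    set r := (z + 3) % 7
    have hz : z = r + 7 * q - 3 := by linarith
    rw [hz]
    rcases lt_trichotomy q 0 with hq | hq | hq
    · nlinarith
    · simp [hq]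
    · nlinarith
  have h : ∀ j : Fin 7, ((((j : ℕ) : ℤ) + (3 - m) % 7) % 7 - 3) ^ 2 ≤ (a j - m) ^ 2 := fun j => by
    convert key (a j - m) using 3
    rw [← ha j]; omega
  refine le_trans ?_ (Finset.sum_le_sum fun j _ => h j)
  have h2 := Int.emod_nonneg (3 - m) (show (7 : ℤ) ≠ 0 by norm_num)
  have h3 := Int.emod_lt_of_pos (3 - m) (show (0 : ℤ) < 7 by norm_num)
  generalize (3 - m) % 7 = r at h2 h3
  interval_cases r <;> decide

theorem le_inhomogeneousMinimum_gramADual_six : 4 / 7 ≤ inhomogeneousMinimum (gramADual 6) := by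
  -- The witness is the centroid of the simplex of the origin and the basis vectors.
  refine le_inhomogeneousMinimum posDef_gramADual_six.posSemidef (fun _ => 1 / 7) fun w => ?_
  -- The `a j` are `7` times the sums of the last `j` coordinates of `x - w`, and the integer
  -- subtracted below is their mean. The sum of squared deviations is `49` times the form, whence
  -- `28 / 49 = 4 / 7`.
  have h := le_sum_sub_sq (a := ![0, 1 - 7 * w 5, 2 - 7 * (w 5 + w 4), 3 - 7 * (w 5 + w 4 + w 3),
    4 - 7 * (w 5 + w 4 + w 3 + w 2), 5 - 7 * (w 5 + w 4 + w 3 + w 2 + w 1),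
    6 - 7 * (w 5 + w 4 + w 3 + w 2 + w 1 + w 0)])
    (fun j => by fin_cases j <;> simp)
    (3 - (6 * w 5 + 5 * w 4 + 4 * w 3 + 3 * w 2 + 2 * w 1 + w 0))
  simp only [Fin.sum_univ_seven] at h
  have h' := (Int.cast_le (R := ℝ)).2 h
  push_cast at h'
  simp at h'
  rw [gramADual_six_eq]
  simp [formEval, gramNum, Fin.sum_univ_six]
  linarith

theorem inhomogeneousMinimum_gramADual_six : inhomogeneousMinimum (gramADual 6) = 4 / 7 :=
  le_antisymm inhomogeneousMinimum_gramADual_six_le le_inhomogeneousMinimum_gramADual_six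

theorem coveringDensity_gramADual_six :
    coveringDensity (gramADual 6) = 64 / 343 * √7 * (Real.pi ^ 3 / 6) := by
  rw [coveringDensity, inhomogeneousMinimum_gramADual_six, det_gramADual_six, unitBallVolume_six,
    show ((4 / 7) ^ 6 / 7⁻¹ : ℝ) = (64 / 343) ^ 2 * 7 by norm_num, Real.sqrt_mul (by norm_num),
    Real.sqrt_sq (by norm_num)]

theorem abs_coveringDensity_gramADual_six_sub_lt :
    |coveringDensity (gramADual 6) - 2.5511| < 0.00005 := by
  have h1 : (2.64575 : ℝ) ≤ √7 := Real.le_sqrt_of_sq_le (by norm_num)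
  have h2 : √7 ≤ (2.64576 : ℝ) := Real.sqrt_le_iff.2 (by norm_num)
  have h3 : (3.141592 : ℝ) ^ 3 ≤ Real.pi ^ 3 := pow_le_pow_left₀ (by norm_num) Real.pi_gt_d6.le 3
  have h4 : Real.pi ^ 3 ≤ (3.141593 : ℝ) ^ 3 := pow_le_pow_left₀ Real.pi_nonneg Real.pi_lt_d6.le 3
  rw [coveringDensity_gramADual_six, abs_lt, neg_lt_sub_iff_lt_add, sub_lt_iff_lt_add]
  constructor
  · have : 64 / 343 * 2.64575 * (3.141592 ^ 3 / 6) ≤ 64 / 343 * √7 * (Real.pi ^ 3 / 6) := by gcongr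
    norm_num at this ⊢; linarith
  · calc _ ≤ 64 / 343 * 2.64576 * ((3.141593 : ℝ) ^ 3 / 6) := by gcongr
      _ < _ := by norm_num

end LatticeCovering

theorem mainTheorem2 :
    LatticeCovering.Qcov.PosDef ∧
    LatticeCovering.coveringDensity LatticeCovering.Qcov < 2.464801 ∧
    LatticeCovering.coveringDensity LatticeCovering.Qcov <
      LatticeCovering.coveringDensity (LatticeCovering.gramADual 6) ∧
    |LatticeCovering.coveringDensity (LatticeCovering.gramADual 6) - 2.5511| < 0.00005 := by
  have h1 := LatticeCovering.coveringDensity_Qcov_lt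
  have h2 := LatticeCovering.abs_coveringDensity_gramADual_six_sub_lt
  refine ⟨LatticeCovering.posDef_Qcov, h1, h1.trans ?_, h2⟩
  have h3 := (abs_lt.1 h2).1
  norm_num at h3 ⊢
  linarith
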